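/- For integers $n\ge 1$, $k\ge 1$ put $H_n=\sum_{j=1}^n\frac1j$ and $L_n(k)=\sum_{j=1}^n\frac{(-1)^{j-1}}{j^k}$. All infinite series are limits of their partial sums in the natural order. Let $\zeta(s)=\sum_{n\ge1}\frac1{n^s}$ $(s\ge2)$ and $\bar\zeta(s)=\sum_{n\ge1}\frac{(-1)^{n-1}}{n^s}$ $(s\ge1)$, and for integers $s,t\ge 1$ let $$\zeta^\star(s,t)=\sum_{m=1}^\infty\frac1{m^s}\sum_{k=1}^m\frac1{k^t},\qquad \zeta^\star(\bar s,t)=\sum_{m=1}^\infty\frac{(-1)^m}{m^s}\sum_{k=1}^m\frac1{k^t},$$ $$\zeta^\star(s,\bar t)=\sum_{m=1}^\infty\frac1{m^s}\sum_{k=1}^m\frac{(-1)^k}{k^t},\qquad \zeta^\star(\bar s,\bar t)=\sum_{m=1}^\infty\frac{(-1)^m}{m^s}\sum_{k=1}^m\frac{(-1)^k}{k^t},$$ where $s\ge2$ is required when the first entry $s$ carries no bar. Theorem. All the series just defined converge. Moreover, for every integer $p\ge1$ the series $\sum_{n\ge1} L_n(1)^2/n^{p+1}$ and $\sum_{n\ge1}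 H_nL_n(1)/n^{p+1}$ converge, and $$\begin{aligned} &\sum_{n=1}^\infty\frac{L_n(1)^2}{n^{p+1}}+\bigl((-1)^{p-1}-1\bigr)\sum_{n=1}^\infty\frac{H_nL_n(1)}{n^{p+1}}\\ &=\zeta^\star(p+1,\bar2)-\ln2\,\zeta^\star(p+1,\bar1)+\zeta^\star(\overline{p+2},\bar1)+\tfrac12\zeta(2)\zeta(p+1)\\ &\quad+\sum_{i=1}^{p+1}\zeta^\star(\bar i,\bar1)\,\bar\zeta(p+2-i)+\bigl(p+1+(-1)^p\bigr)\zeta^\star(p+2,\bar1)\\ &\quad+\tfrac12\ln^22\,\bigl\{2\zeta(p+1)+\bar\zeta(p+1)\bigr\}+(-1)^{p-1}\ln2\,\bigl(\zeta^\star(p+1,1)-\zeta^\star(\overline{p+1},1)\bigr)\\ &\quad-\sum_{i=1}^{p-1}(-1)^{i-1}\bar\zeta(p+1-i)\,\zeta^\star(\overline{i+1},1)-\ln2\,\bigl(\zeta^\star(p+1,1)-\zeta^\star(p+1,\bar1)\bigr)\\ &\quad-\sum_{i=1}^{p-1}(-1)^{i-1}\bar\zeta(p+1-i)\,\bar\zeta(i+2)-(-1)^{p-1}\ln2\,\bigl\{\zeta(p+2)+\bar\zeta(p+2)\bigr\}.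 \end{aligned}$$ -/

import Mathlib

namespace EulerSum

noncomputable section

open Finset

/-- The infinite series `a 1 + a 2 + a 3 + ⋯` converges, that is, its sequence of partial sums,
taken in the natural order, has a limit. Absolute convergence is not required. -/
def Converges (a : ℕ → ℝ) : Prop :=
  Summable (fun n : ℕ => a (n + 1)) (SummationFilter.conditional ℕ)

/-- The value `∑_{n ≥ 1} a n`: the limit of the partial sums in the natural order
(meaningful when `Converges a` holds). -/
def series (a : ℕ → ℝ) : ℝ :=
  ∑'[SummationFilter.conditional ℕ] n : ℕ, a (n + 1)

/-- `series` and `Converges` are about the limit of the sequence of ordered partial sums. -/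
theorem converges_and_series_eq_iff (a : ℕ → ℝ) (l : ℝ) :
    (Converges a ∧ series a = l) ↔
      Filter.Tendsto (fun N : ℕ => ∑ n ∈ Icc 1 N, a n) Filter.atTop (nhds l) := by
  have key : HasSum (fun n : ℕ => a (n + 1)) l (SummationFilter.conditional ℕ) ↔
      Filter.Tendsto (fun N : ℕ => ∑ n ∈ Icc 1 N, a n) Filter.atTop (nhds l) := by
    have h : ∀ N : ℕ, ∑ n ∈ Icc 1 N, a n = ∑ n ∈ range N, a (n + 1) := by
      intro N
      rw [Finset.range_eq_Ico, Finset.sum_Ico_add' a 0 N 1]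
      rfl
    simp only [h, HasSum, SummationFilter.conditional_filter_eq_map_range, Filter.tendsto_map'_iff]
    rfl
  rw [← key]
  constructor
  · rintro ⟨h1, h2⟩
    exact h2 ▸ h1.hasSum
  · intro h
    exact ⟨h.summable, h.tsum_eq⟩

/-- The alternating harmonic numbers `L_n(k) = ∑_{j=1}^n (-1)^{j-1} / j^k`. -/
def altHarmonic (n k : ℕ) : ℝ :=
  ∑ j ∈ Icc 1 n, (-1 : ℝ) ^ (j - 1) / (j : ℝ) ^ k

/-- An entry of a multi-index: a natural number `s`, or a natural number with a bar on top. -/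
inductive Index where
  | plain (s : ℕ)
  | bar (s : ℕ)

/-- The factor an index contributes at `n`: `1 / n^s` for `s`, and `(-1)^n / n^s` for `s` with
a bar. -/
def Index.factor : Index → ℕ → ℝ
  | .plain s, n => 1 / (n : ℝ) ^ s
  | .bar s, n => (-1 : ℝ) ^ n / (n : ℝ) ^ s

/-- The integer underlying an index. -/
def Index.weight : Index → ℕ
  | .plain s => s
  | .bar s => s

/-- The indices allowed in the leading position: `s ≥ 2`, or `s ≥ 1` under a bar. -/
def Index.Leading : Index → Prop
  | .plain s => 2 ≤ s
  | .bar s => 1 ≤ s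

/-- The `m`-th term of the double zeta-star series with indices `i`, `j`. -/
def zetaStarTerm (i j : Index) (m : ℕ) : ℝ :=
  i.factor m * ∑ k ∈ Icc 1 m, j.factor k

/-- The double zeta-star value `ζ⋆(i, j) = ∑_{m ≥ k ≥ 1}`, summed over `m` in the natural
order. -/
def zetaStar (i j : Index) : ℝ :=
  series (zetaStarTerm i j)

/-- The zeta values `ζ(s) = ∑_{n ≥ 1} 1 / n^s`. -/
def zetaVal (s : ℕ) : ℝ :=
  series fun n => 1 / (n : ℝ) ^ s

/-- The alternating zeta values `∑_{n ≥ 1} (-1)^{n-1} / n^s`. -/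
def altZeta (s : ℕ) : ℝ :=
  series fun n => (-1 : ℝ) ^ (n - 1) / (n : ℝ) ^ s

end

end EulerSum

namespace EulerSum

open Finset Filter Topology

/-! ### Series as limits of ordered partial sums -/

/-! Write `L_n`, `H_n` for the alternating and ordinary harmonic numbers and `S_n = ∑_{j ≤ n} L_j /
j` (`altHarmonicSum`). The theorem comes from eliminating the unwanted series `∑ S_n / n^(p+1)`
between two evaluations.

The first (`sum_zetaStar_mul_altZeta`, at `a = p + 1`) multiplies out the products in the sum over
`i`. For fixed `m, k` the sum over `i` is geometric: it gives `(1/m^a - 1/k^a) / (k - m)` off the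
diagonal and `a / m^(a+1)` on it. Exchanging the names `m, k` in one half leaves `∑_n kernelSum n N
/ n^a`. Some factors converge only conditionally, so everything is truncated at a common `N`. The
inner sum has a closed limit (`tendsto_kernelSum`) and a bound uniform in `N` (`abs_kernelSum_le`),
and dominated convergence yields the combination `∑ (L_n² - H_n L_n + S_n) / n^a` plus zeta values.

The second evaluates the absolutely convergent double series of `mixedTerm` in both orders. Partial
fractions in `k` produce `(-1)^p ∑ H_n L_n / n^(p+1)` (`tsum_mixedTerm_eq_rows`). Summing over `m`
first produces `-∑ S_n / n^(p+1)` (`tsum_mixedTerm_eq_cols`). Substituting for the `S_n` series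
turns the coefficient of the `H_n L_n` series into `(-1)^(p-1) - 1`. -/

/-- The partial sums `a 1 + ⋯ + a N` tend to `l`. -/
def SumsTo (a : ℕ → ℝ) (l : ℝ) : Prop :=
  Tendsto (fun N : ℕ => ∑ n ∈ Icc 1 N, a n) atTop (𝓝 l)

theorem SumsTo.converges {a : ℕ → ℝ} {l : ℝ} (h : SumsTo a l) : Converges a :=
  ((converges_and_series_eq_iff a l).2 h).1

theorem Converges.sumsTo {a : ℕ → ℝ} (h : Converges a) : SumsTo a (series a) :=
  (converges_and_series_eq_iff a _).1 ⟨h, rfl⟩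

theorem SumsTo.unique {a : ℕ → ℝ} {l l' : ℝ} (h : SumsTo a l) (h' : SumsTo a l') : l = l' :=
  tendsto_nhds_unique h h'

theorem SumsTo.congr {a b : ℕ → ℝ} {l : ℝ} (h : SumsTo a l) (hab : ∀ n, 1 ≤ n → a n = b n) :
    SumsTo b l :=
  Tendsto.congr (fun _ => sum_congr rfl fun n hn => hab n (mem_Icc.1 hn).1) h

theorem SumsTo.add {a b : ℕ → ℝ} {l m : ℝ} (h : SumsTo a l) (h' : SumsTo b m) :
    SumsTo (fun n => a n + b n) (l + m) := by
  simpa only [SumsTo, sum_add_distrib] using Tendsto.add h h'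

theorem SumsTo.sub {a b : ℕ → ℝ} {l m : ℝ} (h : SumsTo a l) (h' : SumsTo b m) :
    SumsTo (fun n => a n - b n) (l - m) := by
  simpa only [SumsTo, sum_sub_distrib] using Tendsto.sub h h'

theorem SumsTo.const_mul {a : ℕ → ℝ} {l : ℝ} (c : ℝ) (h : SumsTo a l) :
    SumsTo (fun n => c * a n) (c * l) := by
  simpa only [SumsTo, mul_sum] using Tendsto.const_mul c h

theorem SumsTo.neg {a : ℕ → ℝ} {l : ℝ} (h : SumsTo a l) : SumsTo (fun n => -a n) (-l) := by
  simpa only [SumsTo, sum_neg_distrib] using Tendsto.neg h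

theorem SumsTo.finset_sum {ι : Type*} (s : Finset ι) {a : ι → ℕ → ℝ} {l : ι → ℝ}
    (h : ∀ i ∈ s, SumsTo (a i) (l i)) :
    SumsTo (fun n => ∑ i ∈ s, a i n) (∑ i ∈ s, l i) := by
  have := tendsto_finsetSum s h
  refine this.congr fun N => ?_
  rw [sum_comm]

theorem Converges.congr {a b : ℕ → ℝ} (h : Converges a) (hab : ∀ n, 1 ≤ n → a n = b n) :
    Converges b :=
  (h.sumsTo.congr hab).converges

theorem sum_Icc_one_eq_range {a : ℕ → ℝ} (h0 : a 0 = 0) (N : ℕ) :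
    ∑ n ∈ Icc 1 N, a n = ∑ n ∈ range (N + 1), a n := by
  induction N with
  | zero => simp [h0]
  | succ N ih => rw [sum_Icc_succ_top (by omega), ih, sum_range_succ _ (N + 1)]

theorem sumsTo_of_hasSum {a : ℕ → ℝ} {l : ℝ} (h : HasSum a l) (h0 : a 0 = 0) : SumsTo a l :=
  ((tendsto_add_atTop_iff_nat 1).2 h.tendsto_sum_nat).congr fun N =>
    (sum_Icc_one_eq_range h0 N).symm

/-- Under absolute convergence the ordered value is the unordered one. This is the passage from
explicit partial sums to the Fubini and dominated convergence arguments. -/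
theorem hasSum_of_sumsTo {a : ℕ → ℝ} {l : ℝ} (h : Summable a) (h0 : a 0 = 0) (hl : SumsTo a l) :
    HasSum a l := by
  rw [hl.unique (sumsTo_of_hasSum h.hasSum h0)]
  exact h.hasSum

theorem converges_of_summable {a : ℕ → ℝ} (h : Summable a) (h0 : a 0 = 0) : Converges a :=
  (sumsTo_of_hasSum h.hasSum h0).converges

/-! ### Signs, harmonic numbers and alternating harmonic numbers -/

/-- The sign `(-1)^(n-1)`, extended to `n = 0` by `-1`. -/
def alt (n : ℕ) : ℝ := (-1) ^ (n + 1)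

theorem alt_succ (n : ℕ) : alt (n + 1) = -alt n := by simp [alt, pow_succ]

theorem alt_add (m n : ℕ) : alt (m + n) = -(alt m * alt n) := by
  simp only [alt, pow_add, pow_one]; ring

theorem alt_mul_self (n : ℕ) : alt n * alt n = 1 := by
  rw [alt, ← pow_add, ← two_mul]; simp

theorem abs_alt (n : ℕ) : |alt n| = 1 := by simp [alt, abs_pow]

theorem neg_one_pow_eq (n : ℕ) : (-1 : ℝ) ^ n = -alt n := by simp [alt, pow_succ]

theorem neg_one_pow_pred {n : ℕ} (hn : 1 ≤ n) : (-1 : ℝ) ^ (n - 1) = alt n := by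
  obtain ⟨m, rfl⟩ := Nat.exists_eq_add_of_le' hn
  simp [alt, pow_succ]

/-- Harmonic numbers as real numbers. -/
def harm (n : ℕ) : ℝ := (harmonic n : ℝ)

theorem harm_succ (n : ℕ) : harm (n + 1) = harm n + 1 / ((n : ℝ) + 1) := by
  simp [harm, harmonic_succ]

theorem harm_eq_sum (n : ℕ) : harm n = ∑ k ∈ Icc 1 n, 1 / (k : ℝ) := by
  induction n with
  | zero => simp [harm]
  | succ n ih => rw [harm_succ, ih, sum_Icc_succ_top (by omega)]; simp

theorem harm_nonneg (n : ℕ) : 0 ≤ harm n := by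
  rw [harm_eq_sum]; positivity

theorem harm_mono : Monotone harm := by
  refine monotone_nat_of_le_succ fun n => ?_
  rw [harm_succ]
  have : (0 : ℝ) ≤ 1 / ((n : ℝ) + 1) := by positivity
  linarith

theorem one_le_harm {n : ℕ} (hn : 1 ≤ n) : 1 ≤ harm n := by
  refine le_trans ?_ (harm_mono hn)
  simp [harm]

theorem harm_le_rpow {n : ℕ} (hn : 1 ≤ n) : harm n ≤ 5 * (n : ℝ) ^ (1 / 4 : ℝ) := by
  have h1 : harm n ≤ 1 + Real.log n := harmonic_le_one_add_log n
  -- The exponent 1/4 makes `H_n²` cost only `n^(1/2)`, so that dividing by `n²` still leaves the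
  -- summable `n^(-3/2)`.
  have h2 := Real.log_le_rpow_div (x := n) (by positivity) (show (0 : ℝ) < 1 / 4 by norm_num)
  have h3 : (1 : ℝ) ≤ (n : ℝ) ^ (1 / 4 : ℝ) :=
    Real.one_le_rpow (by exact_mod_cast hn) (by norm_num)
  linarith

theorem altHarmonic_zero (k : ℕ) : altHarmonic 0 k = 0 := by simp [altHarmonic]

theorem altHarmonic_eq (n k : ℕ) :
    altHarmonic n k = ∑ j ∈ Icc 1 n, alt j / (j : ℝ) ^ k :=
  sum_congr rfl fun j hj => by rw [neg_one_pow_pred (mem_Icc.1 hj).1]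

theorem altHarmonic_succ (n k : ℕ) :
    altHarmonic (n + 1) k = altHarmonic n k + alt (n + 1) / ((n : ℝ) + 1) ^ k := by
  rw [altHarmonic_eq, altHarmonic_eq, sum_Icc_succ_top (by omega)]
  push_cast; rfl

theorem altHarmonic_one_succ (n : ℕ) :
    altHarmonic (n + 1) 1 = altHarmonic n 1 + alt (n + 1) / ((n : ℝ) + 1) := by
  rw [altHarmonic_succ, pow_one]

theorem abs_sum_le_harm {c : ℕ → ℝ} (hc : ∀ k, 1 ≤ k → |c k| ≤ 1 / (k : ℝ)) (n : ℕ) :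
    |∑ k ∈ Icc 1 n, c k| ≤ harm n := by
  rw [harm_eq_sum]
  exact (abs_sum_le_sum_abs _ _).trans (sum_le_sum fun k hk => hc k (mem_Icc.1 hk).1)

theorem one_div_pow_le {k t : ℕ} (hk : 1 ≤ k) (ht : 1 ≤ t) : 1 / (k : ℝ) ^ t ≤ 1 / (k : ℝ) := by
  have h : (1 : ℝ) ≤ k := by exact_mod_cast hk
  exact one_div_le_one_div_of_le (by positivity) (le_self_pow₀ h (by omega))

theorem abs_altHarmonic_le_harm (n : ℕ) {k : ℕ} (hk : 1 ≤ k) : |altHarmonic n k| ≤ harm n := by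
  rw [altHarmonic_eq]
  refine abs_sum_le_harm (fun j hj => ?_) n
  rw [abs_div, abs_alt, abs_of_nonneg (by positivity)]
  exact one_div_pow_le hj hk

theorem altHarmonic_eq_range (n : ℕ) :
    altHarmonic n 1 = ∑ i ∈ range n, (-1 : ℝ) ^ i * (1 / ((i : ℝ) + 1)) := by
  induction n with
  | zero => simp [altHarmonic]
  | succ n ih =>
    rw [altHarmonic_one_succ, ih, sum_range_succ]
    simp [alt, pow_succ, div_eq_mul_inv]

/-- Subtracting twice the even-indexed terms from `H_{2n}` flips their signs. Combined with `H_n -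
log n → γ`, this identifies the limit of `L_n` as `log 2`. -/
theorem altHarmonic_two_mul (n : ℕ) : altHarmonic (2 * n) 1 = harm (2 * n) - harm n := by
  induction n with
  | zero => simp [altHarmonic, harm]
  | succ n ih =>
    rw [show 2 * (n + 1) = 2 * n + 1 + 1 by ring, altHarmonic_one_succ, altHarmonic_one_succ, ih,
      harm_succ, harm_succ, harm_succ, alt, alt, show (-1 : ℝ) ^ (2 * n + 1 + 1) = 1 by simp [pow_succ, pow_mul],
      show (-1 : ℝ) ^ (2 * n + 1 + 1 + 1) = -1 by simp [pow_succ, pow_mul]]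
    push_cast
    field_simp
    ring

theorem antitone_one_div_add_one : Antitone fun i : ℕ => 1 / ((i : ℝ) + 1) := by
  intro i j h
  have : (i : ℝ) ≤ j := by exact_mod_cast h
  simp only
  gcongr

theorem tendsto_altHarmonic : Tendsto (fun n => altHarmonic n 1) atTop (𝓝 (Real.log 2)) := by
  obtain ⟨l, hl⟩ := antitone_one_div_add_one.tendsto_alternating_series_of_tendsto_zero
    tendsto_one_div_add_atTop_nhds_zero_nat
  simp only [← altHarmonic_eq_range] at hl
  have h2 : Tendsto (fun n : ℕ => 2 * n) atTop atTop := by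
    refine tendsto_atTop_mono (fun n => ?_) tendsto_id
    simp only [id]; omega
  have hH := Real.tendsto_harmonic_sub_log
  have h3 : Tendsto (fun n : ℕ => altHarmonic (2 * n) 1) atTop (𝓝 (Real.log 2)) := by
    have := ((hH.comp h2).sub hH).add_const (Real.log 2)
    rw [sub_self, zero_add] at this
    refine this.congr' ?_
    filter_upwards [eventually_ge_atTop 1] with n hn
    have hn' : (n : ℝ) ≠ 0 := by positivity
    simp only [altHarmonic_two_mul, harm, Function.comp]
    push_cast
    rw [Real.log_mul (by norm_num) hn']
    ring
  rwa [tendsto_nhds_unique (hl.comp h2) h3] at hl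

/-- Consecutive partial sums of the alternating series bracket its limit, so the error is at most
the next term. -/
theorem abs_altHarmonic_sub_log_two_le (n : ℕ) :
    |altHarmonic n 1 - Real.log 2| ≤ 1 / ((n : ℝ) + 1) := by
  have hl := tendsto_altHarmonic
  simp only [altHarmonic_eq_range] at hl
  have h1 := fun k => antitone_one_div_add_one.alternating_series_le_tendsto hl k
  have h2 := fun k => antitone_one_div_add_one.tendsto_le_alternating_series hl k
  simp only [← altHarmonic_eq_range] at h1 h2
  have h3 := altHarmonic_one_succ n
  have h4 : |alt (n + 1) / ((n : ℝ) + 1)| = 1 / ((n : ℝ) + 1) := by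
    rw [abs_div, abs_alt, abs_of_nonneg (by positivity)]
  rw [abs_le]
  obtain ⟨k, rfl | rfl⟩ := n.even_or_odd'
  · have := h1 k; have := h2 k
    have := le_abs_self (alt (2 * k + 1) / (((2 * k : ℕ) : ℝ) + 1))
    have : (0 : ℝ) ≤ 1 / (((2 * k : ℕ) : ℝ) + 1) := by positivity
    constructor <;> linarith
  · have := h1 (k + 1); have := h2 k
    have := neg_abs_le (alt (2 * k + 1 + 1) / (((2 * k + 1 : ℕ) : ℝ) + 1))
    have : (0 : ℝ) ≤ 1 / (((2 * k + 1 : ℕ) : ℝ) + 1) := by positivity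
    rw [show 2 * (k + 1) = 2 * k + 1 + 1 by ring] at *
    constructor <;> linarith

/-! ### Convergence criteria -/

theorem summable_div_pow_of_abs_le {c : ℕ → ℝ} {C : ℝ} (hc : ∀ n, 1 ≤ n → |c n| ≤ C * harm n ^ 2)
    {s : ℕ} (hs : 2 ≤ s) : Summable fun n => c n / (n : ℝ) ^ s := by
  have hC : 0 ≤ C := by
    have := (abs_nonneg _).trans (hc 1 le_rfl)
    simpa [harm] using this
  have hsum : Summable fun n : ℕ => 25 * C * (1 / (n : ℝ) ^ (3 / 2 : ℝ)) :=
    (Real.summable_one_div_nat_rpow.2 (by norm_num)).mul_left _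
  refine Summable.of_norm_bounded_eventually_nat hsum ?_
  filter_upwards [eventually_ge_atTop 1] with n hn
  have hn0 : (0 : ℝ) < n := by exact_mod_cast hn
  have hn1 : (1 : ℝ) ≤ n := by exact_mod_cast hn
  have h1 : harm n ^ 2 ≤ 25 * (n : ℝ) ^ (1 / 2 : ℝ) := by
    calc harm n ^ 2 ≤ (5 * (n : ℝ) ^ (1 / 4 : ℝ)) ^ 2 := by
          gcongr
          · exact harm_nonneg n
          · exact harm_le_rpow hn
      _ = 25 * (n : ℝ) ^ (1 / 2 : ℝ) := by
          rw [mul_pow, ← Real.rpow_natCast, ← Real.rpow_natCast, ← Real.rpow_mul hn0.le]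
          norm_num
  have h2 : (n : ℝ) ^ (1 / 2 : ℝ) * (n : ℝ) ^ (3 / 2 : ℝ) = (n : ℝ) ^ 2 := by
    rw [← Real.rpow_add hn0, ← Real.rpow_natCast]; norm_num
  rw [Real.norm_eq_abs, abs_div, abs_of_pos (show (0 : ℝ) < (n : ℝ) ^ s by positivity)]
  calc |c n| / (n : ℝ) ^ s ≤ C * (25 * (n : ℝ) ^ (1 / 2 : ℝ)) / (n : ℝ) ^ 2 := by
        gcongr
        · exact (hc n hn).trans (by gcongr)
    _ = _ := by
        rw [← h2]
        have : (n : ℝ) ^ (1 / 2 : ℝ) ≠ 0 := (Real.rpow_pos_of_pos hn0 _).ne'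
        have : (n : ℝ) ^ (3 / 2 : ℝ) ≠ 0 := (Real.rpow_pos_of_pos hn0 _).ne'
        field_simp

theorem abs_le_harm_sq {c : ℝ} {n : ℕ} (hn : 1 ≤ n) (hc : |c| ≤ harm n) :
    |c| ≤ 1 * harm n ^ 2 := by
  have := one_le_harm hn
  nlinarith

theorem summable_div_pow {c : ℕ → ℝ} (hc : ∀ n, 1 ≤ n → |c n| ≤ harm n)
    {s : ℕ} (hs : 2 ≤ s) : Summable fun n => c n / (n : ℝ) ^ s :=
  summable_div_pow_of_abs_le (fun n hn => abs_le_harm_sq hn (hc n hn)) hs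

theorem converges_div_pow_of_abs_le {c : ℕ → ℝ} {C : ℝ}
    (hc : ∀ n, 1 ≤ n → |c n| ≤ C * harm n ^ 2) {s : ℕ} (hs : 2 ≤ s) :
    Converges fun n => c n / (n : ℝ) ^ s :=
  converges_of_summable (summable_div_pow_of_abs_le hc hs) (by simp; omega)

/-- An alternating series whose terms tend to zero with summable differences converges. -/
theorem converges_alt_mul {f : ℕ → ℝ} (h0 : Tendsto f atTop (𝓝 0))
    (hf : Summable fun n => f (n + 2) - f (n + 1)) : Converges fun n => alt n * f n := by
  -- Summation by parts: averaging the series with its shift leaves boundary terms and a series in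
  -- the differences of `f`, which converges absolutely.
  have key : ∀ N : ℕ, ∑ n ∈ Icc 1 (N + 1), alt n * f n =
      (f 1 + alt (N + 1) * f (N + 1) + ∑ n ∈ range N, alt n * (f (n + 2) - f (n + 1))) / 2 := by
    intro N
    induction N with
    | zero => simp [alt]
    | succ N ih =>
      rw [sum_Icc_succ_top (by omega), ih, sum_range_succ, alt_succ (N + 1), alt_succ N]
      ring
  have h1 : Summable fun n => alt n * (f (n + 2) - f (n + 1)) := by
    refine Summable.of_norm ?_
    refine hf.norm.congr fun n => ?_
    rw [norm_mul, Real.norm_eq_abs (alt n), abs_alt, one_mul]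
  have h2 : Tendsto (fun N => alt (N + 1) * f (N + 1)) atTop (𝓝 0) := by
    rw [tendsto_zero_iff_abs_tendsto_zero]
    have := (tendsto_add_atTop_iff_nat 1).2 (tendsto_zero_iff_abs_tendsto_zero _ |>.1 h0)
    refine this.congr fun n => ?_
    simp [abs_mul, abs_alt]
  have h3 := ((h2.const_add (f 1)).add h1.hasSum.tendsto_sum_nat).div_const 2
  have h4 : SumsTo (fun n => alt n * f n) _ :=
    (tendsto_add_atTop_iff_nat 1).1 (h3.congr fun N => (key N).symm)
  exact h4.converges

theorem tendsto_harm_div : Tendsto (fun n : ℕ => harm n / (n : ℝ)) atTop (𝓝 0) := by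
  have h : Tendsto (fun n : ℕ => 5 * (n : ℝ) ^ (-(3 / 4) : ℝ)) atTop (𝓝 (5 * 0)) :=
    ((tendsto_rpow_neg_atTop (by norm_num)).comp tendsto_natCast_atTop_atTop).const_mul 5
  rw [mul_zero] at h
  refine squeeze_zero' (Eventually.of_forall fun n => ?_) ?_ h
  · have := harm_nonneg n; positivity
  · filter_upwards [eventually_ge_atTop 1] with n hn
    have hn0 : (0 : ℝ) < n := by exact_mod_cast hn
    rw [div_le_iff₀ hn0]
    refine (harm_le_rpow hn).trans_eq ?_
    rw [mul_assoc]
    nth_rw 3 [← Real.rpow_one (n : ℝ)]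
    rw [← Real.rpow_add hn0]
    norm_num

/-- This covers a leading entry 1 under a bar, where absolute convergence is not available: the
differences of `S_n / n` are `O(H_n / n²)`, and `H_n / n → 0`. -/
theorem converges_alt_sum_div {c : ℕ → ℝ} (hc : ∀ k, 1 ≤ k → |c k| ≤ 1 / (k : ℝ)) :
    Converges fun n => alt n * ((∑ k ∈ Icc 1 n, c k) / (n : ℝ)) := by
  refine converges_alt_mul ?_ ?_
  · refine squeeze_zero_norm (fun n => ?_) tendsto_harm_div
    rw [Real.norm_eq_abs, abs_div, Nat.abs_cast]
    gcongr
    exact abs_sum_le_harm hc n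
  · have h1 : Summable fun n : ℕ => 2 * (harm (n + 1) / ((n + 1 : ℕ) : ℝ) ^ 2) :=
      ((summable_nat_add_iff 1).2 (summable_div_pow (c := harm) (s := 2)
        (fun n _ => (abs_of_nonneg (harm_nonneg n)).le) le_rfl)).mul_left 2
    refine Summable.of_norm_bounded h1 fun n => ?_
    have hn : (0 : ℝ) < (n : ℝ) + 1 := by positivity
    rw [show n + 2 = n + 1 + 1 by ring, sum_Icc_succ_top (by omega)]
    set S := ∑ k ∈ Icc 1 (n + 1), c k with hS
    have hS' : |S| ≤ harm (n + 1) := abs_sum_le_harm hc (n + 1)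
    have hc' := hc (n + 1 + 1) (by omega)
    have hh := one_le_harm (n := n + 1) (by omega)
    push_cast at hc' ⊢
    have e : (S + c (n + 1 + 1)) / ((n : ℝ) + 1 + 1) - S / ((n : ℝ) + 1) =
        c (n + 1 + 1) / ((n : ℝ) + 1 + 1) - S / (((n : ℝ) + 1) * ((n : ℝ) + 1 + 1)) := by
      field_simp; ring
    rw [Real.norm_eq_abs, e]
    refine (abs_sub _ _).trans ?_
    rw [abs_div, abs_div, abs_of_pos (show (0 : ℝ) < (n : ℝ) + 1 + 1 by positivity),
      abs_of_pos (show (0 : ℝ) < ((n : ℝ) + 1) * ((n : ℝ) + 1 + 1) by positivity)]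
    have h2 : |c (n + 1 + 1)| / ((n : ℝ) + 1 + 1) ≤ harm (n + 1) / ((n : ℝ) + 1) ^ 2 := by
      calc |c (n + 1 + 1)| / ((n : ℝ) + 1 + 1) ≤ (1 / ((n : ℝ) + 1 + 1)) / ((n : ℝ) + 1 + 1) := by
            gcongr
        _ = 1 / ((n : ℝ) + 1 + 1) ^ 2 := by rw [div_div, sq]
        _ ≤ harm (n + 1) / ((n : ℝ) + 1) ^ 2 := by
            gcongr
            linarith
    have h3 : |S| / (((n : ℝ) + 1) * ((n : ℝ) + 1 + 1)) ≤ harm (n + 1) / ((n : ℝ) + 1) ^ 2 := by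
      gcongr
      nlinarith
    linarith

theorem abs_factor_le (j : Index) {k : ℕ} (hk : 1 ≤ k) (hj : 1 ≤ j.weight) :
    |j.factor k| ≤ 1 / (k : ℝ) := by
  cases j with
  | plain t =>
    simp only [Index.factor, Index.weight] at *
    rw [abs_of_nonneg (by positivity)]
    exact one_div_pow_le hk hj
  | bar t =>
    simp only [Index.factor, Index.weight] at *
    rw [neg_one_pow_eq, abs_div, abs_neg, abs_alt, abs_of_nonneg (by positivity)]
    exact one_div_pow_le hk hj

theorem converges_zetaStarTerm (i j : Index) (hi : i.Leading) (hj : 1 ≤ j.weight) :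
    Converges (zetaStarTerm i j) := by
  have hb : ∀ n, |∑ k ∈ Icc 1 n, j.factor k| ≤ harm n :=
    abs_sum_le_harm fun k hk => abs_factor_le j hk hj
  cases i with
  | plain s =>
    refine (converges_div_pow_of_abs_le
      (fun n hn => abs_le_harm_sq hn (hb n)) hi).congr fun n _ => ?_
    simp only [zetaStarTerm, Index.factor]; ring
  | bar s =>
    simp only [Index.Leading] at hi
    rcases hi.lt_or_eq with hs | rfl
    · refine (converges_div_pow_of_abs_le (c := fun n => -alt n * ∑ k ∈ Icc 1 n, j.factor k)
        (fun n hn => abs_le_harm_sq hn ?_) hs).congr fun n _ => ?_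
      · rw [abs_mul, abs_neg, abs_alt, one_mul]; exact hb n
      · simp only [zetaStarTerm, Index.factor, neg_one_pow_eq]; ring
    · refine (converges_alt_sum_div fun k hk =>
        abs_factor_le j hk hj).sumsTo.neg.converges.congr fun n _ => ?_
      simp only [zetaStarTerm, Index.factor, neg_one_pow_eq]; ring

theorem sumsTo_alt_div : SumsTo (fun n => alt n / (n : ℝ)) (Real.log 2) :=
  tendsto_altHarmonic.congr fun n => by simp only [altHarmonic_eq, pow_one]

theorem converges_zetaVal {s : ℕ} (hs : 2 ≤ s) : Converges fun n => 1 / (n : ℝ) ^ s :=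
  converges_div_pow_of_abs_le (c := fun _ => 1)
    (fun n hn => abs_le_harm_sq hn (by simpa using one_le_harm hn)) hs

theorem sumsTo_alt_div_pow {s : ℕ} (hs : 1 ≤ s) :
    SumsTo (fun n => alt n / (n : ℝ) ^ s) (altZeta s) := by
  suffices h : Converges fun n => alt n / (n : ℝ) ^ s by
    have h2 : Converges fun n => (-1 : ℝ) ^ (n - 1) / (n : ℝ) ^ s :=
      h.congr fun n hn => by rw [neg_one_pow_pred hn]
    exact h2.sumsTo.congr fun n hn => by rw [neg_one_pow_pred hn]
  rcases hs.lt_or_eq with hs | rfl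
  · exact converges_div_pow_of_abs_le
      (fun n hn => abs_le_harm_sq hn (by simpa [abs_alt] using one_le_harm hn)) hs
  · simpa using sumsTo_alt_div.converges

theorem converges_altZeta {s : ℕ} (hs : 1 ≤ s) :
    Converges fun n => (-1 : ℝ) ^ (n - 1) / (n : ℝ) ^ s :=
  (sumsTo_alt_div_pow hs).converges.congr fun n hn => by rw [neg_one_pow_pred hn]

theorem altZeta_one : altZeta 1 = Real.log 2 :=
  (sumsTo_alt_div_pow le_rfl).unique (by simpa using sumsTo_alt_div)

/-! ### Auxiliary alternating sums -/

theorem harm_pred (n : ℕ) : harm (n - 1) = harm n - 1 / (n : ℝ) := by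
  cases n with
  | zero => simp
  | succ n => rw [harm_succ]; simp

theorem harm_eq_range (n : ℕ) : harm n = ∑ i ∈ range n, 1 / ((i : ℝ) + 1) := by
  induction n with
  | zero => simp [harm]
  | succ n ih => rw [harm_succ, ih, sum_range_succ]

theorem abs_altHarmonic_le_two (n : ℕ) : |altHarmonic n 1| ≤ 2 := by
  have h1 := abs_altHarmonic_sub_log_two_le n
  have h2 : 1 / ((n : ℝ) + 1) ≤ 1 := by
    rw [div_le_one (by positivity)]
    have : (0 : ℝ) ≤ n := by positivity
    linarith
  have h3 := Real.log_two_lt_d9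
  have h4 := Real.log_two_gt_d9
  rw [abs_le] at *
  constructor <;> linarith

/-- Partial sums `∑_{j ≤ n} L_j(1) / j`. -/
noncomputable def altHarmonicSum (n : ℕ) : ℝ := ∑ j ∈ Icc 1 n, altHarmonic j 1 / (j : ℝ)

/-- Partial sums `∑_{r ≤ n} (-1)^(r-1) H_r / r`. -/
noncomputable def altHarmSum (n : ℕ) : ℝ := ∑ r ∈ Icc 1 n, alt r * harm r / (r : ℝ)

theorem altHarmonicSum_succ (n : ℕ) :
    altHarmonicSum (n + 1) = altHarmonicSum n + altHarmonic (n + 1) 1 / ((n : ℝ) + 1) := by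
  rw [altHarmonicSum, sum_Icc_succ_top (by omega), ← altHarmonicSum]; simp

theorem altHarmSum_succ (n : ℕ) :
    altHarmSum (n + 1) = altHarmSum n + alt (n + 1) * harm (n + 1) / ((n : ℝ) + 1) := by
  rw [altHarmSum, sum_Icc_succ_top (by omega), ← altHarmSum]; simp

theorem abs_altHarmonicSum_le (n : ℕ) : |altHarmonicSum n| ≤ 2 * harm n := by
  rw [altHarmonicSum, harm_eq_sum, mul_sum]
  refine (abs_sum_le_sum_abs _ _).trans (sum_le_sum fun k _ => ?_)
  rw [abs_div, Nat.abs_cast, mul_one_div]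
  gcongr
  exact abs_altHarmonic_le_two k

/-- The product of two finite sums is split according to which index is larger; the diagonal is
counted twice and subtracted once. -/
theorem harm_mul_altHarmonic (n : ℕ) :
    harm n * altHarmonic n 1 = altHarmonicSum n + altHarmSum n - altHarmonic n 2 := by
  induction n with
  | zero => simp [harm, altHarmonic, altHarmonicSum, altHarmSum]
  | succ n ih =>
    rw [altHarmonicSum_succ, altHarmSum_succ, altHarmonic_succ n 2, altHarmonic_one_succ,
      harm_succ]
    have hn : (n : ℝ) + 1 ≠ 0 := by positivity
    have e : altHarmonic n 2 = altHarmonicSum n + altHarmSum n - harm n * altHarmonic n 1 := by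
      linarith
    rw [e]
    field_simp
    ring

/-- The same splitting of a square, with diagonal terms `(±1/j)² = 1/j²`. The shift `0 + j` matches
the base case of `sumsTo_alt_mul_altHarmonic_add_div`. -/
theorem altHarmonic_sq (n : ℕ) :
    altHarmonic n 1 ^ 2 + ∑ j ∈ Icc 1 n, 1 / (j : ℝ) ^ 2 =
      2 * ∑ j ∈ Icc 1 n, alt j * altHarmonic (0 + j) 1 / (j : ℝ) := by
  induction n with
  | zero => simp [altHarmonic]
  | succ n ih =>
    rw [sum_Icc_succ_top (by omega), sum_Icc_succ_top (by omega), mul_add, ← ih, zero_add,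
      altHarmonic_one_succ]
    push_cast
    have hn : (n : ℝ) + 1 ≠ 0 := by positivity
    have := alt_mul_self (n + 1)
    field_simp
    linear_combination (-1 : ℝ) * this

theorem sumsTo_alt_mul_altHarmonic_div :
    SumsTo (fun j => alt j * altHarmonic (0 + j) 1 / (j : ℝ))
      ((Real.log 2 ^ 2 + zetaVal 2) / 2) := by
  have h := ((tendsto_altHarmonic.pow 2).add (converges_zetaVal le_rfl).sumsTo).div_const 2
  refine h.congr fun n => ?_
  rw [altHarmonic_sq]; ring

theorem sumsTo_one_div_sub_one_div_add (m : ℕ) :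
    SumsTo (fun j => 1 / (j : ℝ) - 1 / ((j : ℝ) + m)) (harm m) := by
  induction m with
  | zero => simp [SumsTo, harm]
  | succ m ih =>
    have h : SumsTo (fun j => 1 / ((j : ℝ) + m) - 1 / ((j : ℝ) + m + 1)) (1 / ((m : ℝ) + 1)) := by
      have key : ∀ N : ℕ, ∑ j ∈ Icc 1 N, (1 / ((j : ℝ) + m) - 1 / ((j : ℝ) + m + 1)) =
          1 / ((m : ℝ) + 1) - 1 / (((N + m : ℕ) : ℝ) + 1) := by
        intro N
        induction N with
        | zero => simp
        | succ N ih =>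
          rw [sum_Icc_succ_top (by omega), ih]
          push_cast
          ring
      have h1 := (tendsto_add_atTop_iff_nat m).2
        (tendsto_one_div_add_atTop_nhds_zero_nat (𝕜 := ℝ))
      have h2 := h1.const_sub (1 / ((m : ℝ) + 1))
      rw [sub_zero] at h2
      exact h2.congr fun N => (key N).symm
    rw [harm_succ]
    refine (ih.add h).congr fun j _ => ?_
    push_cast; ring

theorem sumsTo_one_div_mul_add {m : ℕ} (hm : 1 ≤ m) :
    SumsTo (fun j => 1 / ((j : ℝ) * ((j : ℝ) + m))) (harm m / m) := by
  have h := (sumsTo_one_div_sub_one_div_add m).const_mul (1 / (m : ℝ))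
  rw [one_div_mul_eq_div] at h
  refine h.congr fun j hj => ?_
  have : (j : ℝ) ≠ 0 := by positivity
  have : (m : ℝ) ≠ 0 := by positivity
  have : (j : ℝ) + m ≠ 0 := by positivity
  field_simp
  ring

/-- Raising `n` by one adds a single term to each `L_{n+j}`. Its sign cancels `alt j`, so the change
is `-alt (n + 1)` times the telescoping series `∑ 1 / (j (j + n + 1))`. -/
theorem sumsTo_alt_mul_altHarmonic_add_div (n : ℕ) :
    SumsTo (fun j => alt j * altHarmonic (n + j) 1 / (j : ℝ))
      ((Real.log 2 ^ 2 + zetaVal 2) / 2 - altHarmSum n) := by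
  induction n with
  | zero => simpa [altHarmSum] using sumsTo_alt_mul_altHarmonic_div
  | succ n ih =>
    have h := ih.sub ((sumsTo_one_div_mul_add (m := n + 1) (by omega)).const_mul (alt (n + 1)))
    rw [altHarmSum_succ]
    push_cast at h
    convert h.congr (b := fun j => alt j * altHarmonic (n + 1 + j) 1 / (j : ℝ)) fun j hj => ?_
      using 1
    · ring
    · have : (j : ℝ) ≠ 0 := by positivity
      have : (j : ℝ) + (n + 1) ≠ 0 := by positivity
      have h1 : alt (n + j + 1) = -(alt (n + 1) * alt j) := by rw [← alt_add]; congr 1; ring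
      have h2 := alt_mul_self j
      rw [show n + 1 + j = n + j + 1 by ring, altHarmonic_one_succ, h1]
      push_cast
      rw [show (n : ℝ) + j + 1 = j + (n + 1) by ring]
      field_simp
      linear_combination (alt (n + 1)) * h2

/-- Up to the sign `-alt m`, this is the tail after `m` of the series for `log 2`. -/
theorem sumsTo_alt_div_add (m : ℕ) :
    SumsTo (fun k => alt k / ((k : ℝ) + m)) (alt m * (altHarmonic m 1 - Real.log 2)) := by
  have key : ∀ N : ℕ, ∑ k ∈ Icc 1 N, alt k / ((k : ℝ) + m) =
      alt m * (altHarmonic m 1 - altHarmonic (N + m) 1) := by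
    intro N
    induction N with
    | zero => simp
    | succ N ih =>
      rw [sum_Icc_succ_top (by omega), ih, show N + 1 + m = N + m + 1 by ring,
        altHarmonic_one_succ, show N + m + 1 = m + (N + 1) by ring, alt_add m (N + 1)]
      have : ((N + m : ℕ) : ℝ) + 1 ≠ 0 := by positivity
      have h2 := alt_mul_self m
      push_cast at *
      rw [show (N : ℝ) + 1 + m = N + m + 1 by ring]
      field_simp
      linear_combination (-alt (N + 1)) * h2
  exact ((((tendsto_add_atTop_iff_nat m).2 tendsto_altHarmonic).const_sub _).const_mul _).congr
    fun N => (key N).symm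

/-- The Cauchy-product sum `∑_{j + l = n} (-1)^(j-1) L_l(1) / j`. -/
noncomputable def altConv (n : ℕ) : ℝ := ∑ q ∈ antidiagonal n, alt q.1 / (q.1 : ℝ) * altHarmonic q.2 1

/-- Since the two denominators add up to `n + 1`, each product is a sum of two reciprocals divided
by `n + 1`. The term with `q.1 = 0` vanishes because `1 / 0 = 0`. -/
theorem sum_antidiagonal_one_div (n : ℕ) :
    ∑ q ∈ antidiagonal n, 1 / (q.1 : ℝ) * (1 / ((q.2 : ℝ) + 1)) = 2 * harm n / ((n : ℝ) + 1) := by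
  cases n with
  | zero => simp [harm]
  | succ n =>
    have h1 : ∑ q ∈ antidiagonal n, 1 / ((q.1 : ℝ) + 1) = harm (n + 1) := by
      rw [harm_eq_range, Nat.sum_antidiagonal_eq_sum_range_succ (fun i _ => 1 / ((i : ℝ) + 1))]
    have h2 : ∑ q ∈ antidiagonal n, 1 / ((q.2 : ℝ) + 1) = harm (n + 1) := by
      rw [← h1, ← Nat.sum_antidiagonal_swap]; rfl
    rw [Nat.sum_antidiagonal_succ]
    simp only [Nat.cast_zero, div_zero, zero_mul, zero_add]
    have h3 : 2 * harm (n + 1) = ∑ q ∈ antidiagonal n,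
        (1 / ((q.1 : ℝ) + 1) + 1 / ((q.2 : ℝ) + 1)) := by
      rw [sum_add_distrib, h1, h2]; ring
    rw [h3, sum_div]
    refine sum_congr rfl fun q hq => ?_
    have hq' : (n : ℝ) = q.1 + q.2 := by exact_mod_cast (mem_antidiagonal.1 hq).symm
    have a1 : (q.1 : ℝ) + 1 ≠ 0 := by positivity
    have a2 : (q.2 : ℝ) + 1 ≠ 0 := by positivity
    have a3 : (q.1 : ℝ) + q.2 + 1 + 1 ≠ 0 := by positivity
    push_cast
    rw [hq']
    field_simp
    ring

theorem altConv_succ (n : ℕ) :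
    altConv (n + 1) = altConv n - 2 * (alt (n + 1) * harm n / ((n : ℝ) + 1)) := by
  have h := sum_antidiagonal_one_div n
  rw [altConv, Nat.sum_antidiagonal_succ']
  simp only [altHarmonic_zero, mul_zero, zero_add, altHarmonic_one_succ, mul_add, sum_add_distrib]
  rw [← altConv, sub_eq_add_neg]
  congr 1
  rw [show -(2 * (alt (n + 1) * harm n / ((n : ℝ) + 1))) =
    -alt (n + 1) * (2 * harm n / ((n : ℝ) + 1)) by ring, ← h, mul_sum]
  refine sum_congr rfl fun q hq => ?_
  rw [← mem_antidiagonal.1 hq, add_assoc, alt_add q.1 (q.2 + 1)]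
  ring

theorem altConv_eq (n : ℕ) :
    altConv n = -2 * ∑ r ∈ Icc 1 n, alt r * harm (r - 1) / (r : ℝ) := by
  induction n with
  | zero => simp [altConv, altHarmonic]
  | succ n ih =>
    rw [sum_Icc_succ_top (by omega), altConv_succ, ih]
    simp only [Nat.add_sub_cancel]
    push_cast; ring

theorem altConv_eq_sub (n : ℕ) : altConv n = 2 * altHarmonic n 2 - 2 * altHarmSum n := by
  rw [altConv_eq, altHarmonic_eq, altHarmSum, ← mul_sub, ← sum_sub_distrib, mul_sum, mul_sum]
  refine sum_congr rfl fun r _ => ?_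
  rw [harm_pred]
  ring

theorem sum_antidiagonal_alt_div (n : ℕ) :
    ∑ q ∈ antidiagonal n, alt q.1 / (q.1 : ℝ) = altHarmonic n 1 := by
  rw [Nat.sum_antidiagonal_eq_sum_range_succ (fun i _ => alt i / (i : ℝ)), altHarmonic_eq]
  simp only [pow_one]
  rw [sum_Icc_one_eq_range (by simp)]

theorem abs_altConv_sub_le (n : ℕ) :
    |altConv n - altHarmonic n 1 * Real.log 2| ≤ 2 * harm n / ((n : ℝ) + 1) := by
  rw [← sum_antidiagonal_alt_div, altConv, sum_mul, ← sum_sub_distrib, ← sum_antidiagonal_one_div]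
  refine (abs_sum_le_sum_abs _ _).trans (sum_le_sum fun q _ => ?_)
  rw [← mul_sub, abs_mul, abs_div, abs_alt, Nat.abs_cast]
  gcongr
  exact abs_altHarmonic_sub_log_two_le _

/-- Replacing `L_l` by `log 2` inside the convolution costs at most `∑ 1 / (j (l + 1)) = 2 H_n / (n
+ 1)`, which tends to 0, although both series converge only conditionally. -/
theorem tendsto_altConv : Tendsto altConv atTop (𝓝 (Real.log 2 ^ 2)) := by
  have h1 : Tendsto (fun n => altConv n - altHarmonic n 1 * Real.log 2) atTop (𝓝 0) := by
    refine squeeze_zero_norm' ?_ (by simpa using tendsto_harm_div.const_mul 2)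
    filter_upwards [eventually_ge_atTop 1] with n hn
    have hn0 : (0 : ℝ) < n := by exact_mod_cast hn
    refine (abs_altConv_sub_le n).trans ?_
    rw [mul_div_assoc]
    have := harm_nonneg n
    gcongr
    linarith
  have h2 := h1.add (tendsto_altHarmonic.mul_const (Real.log 2))
  rw [zero_add, ← sq] at h2
  exact h2.congr fun n => by ring

theorem sumsTo_alt_mul_harm_pred_div :
    SumsTo (fun r => alt r * harm (r - 1) / (r : ℝ)) (-(Real.log 2 ^ 2) / 2) := by
  have h := tendsto_altConv.const_mul (-(1 / 2) : ℝ)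
  rw [show -(1 / 2) * Real.log 2 ^ 2 = -(Real.log 2 ^ 2) / 2 by ring] at h
  exact h.congr fun n => by rw [altConv_eq]; ring

/-! ### The product sum -/

theorem sum_one_div_pow_mul (a : ℕ) {m k : ℝ} (hm : m ≠ 0) (hk : k ≠ 0) :
    (k - m) * ∑ i ∈ Icc 1 a, 1 / (m ^ i * k ^ (a + 1 - i)) = 1 / m ^ a - 1 / k ^ a := by
  induction a with
  | zero => simp
  | succ a ih =>
    have e : ∑ i ∈ Icc 1 a, 1 / (m ^ i * k ^ (a + 1 + 1 - i)) =
        1 / k * ∑ i ∈ Icc 1 a, 1 / (m ^ i * k ^ (a + 1 - i)) := by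
      rw [mul_sum]
      refine sum_congr rfl fun i hi => ?_
      rw [show a + 1 + 1 - i = a + 1 - i + 1 by have := (mem_Icc.1 hi).2; omega, pow_succ]
      field_simp
    rw [sum_Icc_succ_top (by omega), e, mul_add, mul_left_comm, ih,
      show a + 1 + 1 - (a + 1) = 1 by omega]
    field_simp
    ring

theorem sum_one_div_pow_mul_self (a : ℕ) (m : ℝ) :
    ∑ i ∈ Icc 1 a, 1 / (m ^ i * m ^ (a + 1 - i)) = a / m ^ (a + 1) := by
  rw [sum_congr rfl fun i hi => by
    rw [← pow_add, show i + (a + 1 - i) = a + 1 by have := (mem_Icc.1 hi).2; omega]]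
  simp [div_eq_mul_inv]

/-- On the diagonal the quotient is `0 / 0 = 0`, so the `if` supplies the whole value and both cases
fit one formula. -/
theorem sum_one_div_pow_mul_eq (a : ℕ) {m k : ℕ} (hm : 1 ≤ m) (hk : 1 ≤ k) :
    ∑ i ∈ Icc 1 a, 1 / ((m : ℝ) ^ i * (k : ℝ) ^ (a + 1 - i)) =
      (1 / (m : ℝ) ^ a - 1 / (k : ℝ) ^ a) / ((k : ℝ) - m) +
        if m = k then (a : ℝ) / (m : ℝ) ^ (a + 1) else 0 := by
  split_ifs with h
  · subst h
    rw [sum_one_div_pow_mul_self]; simp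
  · have h' : (k : ℝ) - m ≠ 0 := sub_ne_zero.2 (by exact_mod_cast Ne.symm h)
    rw [add_zero, eq_div_iff h', mul_comm]
    exact sum_one_div_pow_mul a (by positivity) (by positivity)

/-- The truncated coefficient `∑_{k ≤ N, k ≠ n} (-1)^(n+k) (L_n + L_k) / (k - n)`. -/
noncomputable def kernelSum (n N : ℕ) : ℝ :=
  ∑ k ∈ Icc 1 N, alt n * alt k * (altHarmonic n 1 + altHarmonic k 1) / ((k : ℝ) - n)

theorem sum_mul_eq_kernelSum (a N : ℕ) :
    ∑ i ∈ Icc 1 a, (∑ m ∈ Icc 1 N, alt m * altHarmonic m 1 / (m : ℝ) ^ i) *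
        (∑ k ∈ Icc 1 N, alt k / (k : ℝ) ^ (a + 1 - i)) =
      a * ∑ m ∈ Icc 1 N, altHarmonic m 1 / (m : ℝ) ^ (a + 1) +
        ∑ n ∈ Icc 1 N, kernelSum n N / (n : ℝ) ^ a := by
  have h1 : ∑ i ∈ Icc 1 a, (∑ m ∈ Icc 1 N, alt m * altHarmonic m 1 / (m : ℝ) ^ i) *
        (∑ k ∈ Icc 1 N, alt k / (k : ℝ) ^ (a + 1 - i)) =
      ∑ m ∈ Icc 1 N, ∑ k ∈ Icc 1 N, alt m * alt k * altHarmonic m 1 *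
        ∑ i ∈ Icc 1 a, 1 / ((m : ℝ) ^ i * (k : ℝ) ^ (a + 1 - i)) := by
    rw [sum_congr rfl fun i _ => sum_mul_sum _ _ _ _, sum_comm]
    refine sum_congr rfl fun m _ => ?_
    rw [sum_comm]
    refine sum_congr rfl fun k _ => ?_
    rw [mul_sum]
    refine sum_congr rfl fun i _ => ?_
    rw [div_mul_div_comm]; ring
  -- The part with `1 / k^a` is written so that interchanging `m` and `k` gives it the same sign and
  -- kernel as the part with `1 / m^a`; together they form the numerator `L_n + L_k`.
  have h2 : ∀ m ∈ Icc 1 N, ∀ k ∈ Icc 1 N, alt m * alt k * altHarmonic m 1 *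
        ∑ i ∈ Icc 1 a, 1 / ((m : ℝ) ^ i * (k : ℝ) ^ (a + 1 - i)) =
      (alt m * alt k * altHarmonic m 1 / ((k : ℝ) - m) / (m : ℝ) ^ a +
        if m = k then a * (altHarmonic m 1 / (m : ℝ) ^ (a + 1)) else 0) +
        alt k * alt m * altHarmonic m 1 / ((m : ℝ) - k) / (k : ℝ) ^ a := by
    intro m hm k hk
    rw [sum_one_div_pow_mul_eq a (mem_Icc.1 hm).1 (mem_Icc.1 hk).1,
      show (m : ℝ) - k = -((k : ℝ) - m) by ring, div_neg]
    split_ifs with h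
    · subst h
      have := alt_mul_self m
      simp only [sub_self, div_zero, zero_div, zero_add, neg_zero, add_zero]
      rw [this]; ring
    · ring
  rw [h1, sum_congr rfl fun m hm => sum_congr rfl (h2 m hm)]
  simp only [sum_add_distrib]
  rw [sum_comm (f := fun m k : ℕ => alt k * alt m * altHarmonic m 1 / ((m : ℝ) - k) / (k : ℝ) ^ a)]
  have h3 : ∑ m ∈ Icc 1 N, ∑ k ∈ Icc 1 N,
      (if m = k then a * (altHarmonic m 1 / (m : ℝ) ^ (a + 1)) else 0) =
      a * ∑ m ∈ Icc 1 N, altHarmonic m 1 / (m : ℝ) ^ (a + 1) := by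
    rw [mul_sum]
    refine sum_congr rfl fun m hm => ?_
    rw [sum_ite_eq, if_pos hm]
  rw [h3, add_comm (∑ m ∈ Icc 1 N, _) (_ * _), add_assoc, ← sum_add_distrib]
  congr 1
  refine sum_congr rfl fun n _ => ?_
  rw [← sum_add_distrib, kernelSum, sum_div]
  refine sum_congr rfl fun k _ => ?_
  ring

theorem sum_Icc_add (f : ℕ → ℝ) (n J : ℕ) :
    ∑ k ∈ Icc 1 (n + J), f k = ∑ k ∈ Icc 1 n, f k + ∑ j ∈ Icc 1 J, f (n + j) := by
  induction J with
  | zero => simp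
  | succ J ih =>
    rw [← add_assoc, sum_Icc_succ_top (by omega), ih, sum_Icc_succ_top (by omega), add_assoc]
    rfl

theorem sum_Icc_eq_sum_antidiagonal (f : ℕ → ℝ) (n : ℕ) :
    ∑ k ∈ Icc 1 n, f k = ∑ q ∈ antidiagonal n, f q.2 - f 0 := by
  induction n with
  | zero => simp
  | succ n ih => rw [sum_Icc_succ_top (by omega), ih, Nat.sum_antidiagonal_succ]; ring

/-- With `k = n - j` the sign becomes `-alt j` and the denominator `-j`, so the sum is a
convolution. The antidiagonal also contains `k = 0`, which accounts for the subtracted term. -/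
theorem kernelSum_self {n : ℕ} (hn : 1 ≤ n) :
    kernelSum n n = altHarmonic n 1 ^ 2 + altConv n - alt n * altHarmonic n 1 / (n : ℝ) := by
  rw [kernelSum, sum_Icc_eq_sum_antidiagonal
    (fun k => alt n * alt k * (altHarmonic n 1 + altHarmonic k 1) / ((k : ℝ) - n))]
  congr 1
  · rw [sq]
    nth_rw 3 [← sum_antidiagonal_alt_div]
    rw [altConv, mul_sum, ← sum_add_distrib]
    refine sum_congr rfl fun q hq => ?_
    have h1 : (n : ℝ) = q.1 + q.2 := by exact_mod_cast (mem_antidiagonal.1 hq).symm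
    have h2 : alt n * alt q.2 = -alt q.1 := by
      rw [← mem_antidiagonal.1 hq, alt_add]
      have := alt_mul_self q.2
      linear_combination (-alt q.1) * this
    rw [h2, h1, show (q.2 : ℝ) - (q.1 + q.2) = -q.1 by ring]
    ring
  · have : (n : ℝ) ≠ 0 := by positivity
    simp [altHarmonic_zero, alt]

theorem kernelSum_add {n : ℕ} (hn : 1 ≤ n) (J : ℕ) :
    kernelSum n (n + J) = altHarmonic n 1 ^ 2 + altConv n - alt n * altHarmonic n 1 / (n : ℝ) -
      (altHarmonic n 1 * altHarmonic J 1 +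
        ∑ j ∈ Icc 1 J, alt j * altHarmonic (n + j) 1 / (j : ℝ)) := by
  rw [← kernelSum_self hn, kernelSum, sum_Icc_add, ← kernelSum, sub_eq_add_neg]
  congr 1
  rw [altHarmonic_eq J, mul_sum, ← sum_add_distrib, ← sum_neg_distrib]
  refine sum_congr rfl fun j _ => ?_
  have := alt_mul_self n
  rw [alt_add]
  push_cast
  rw [add_sub_cancel_left, pow_one, show alt n * -(alt n * alt j) = -alt j by
    linear_combination (-alt j) * this]
  ring

/-- The limit of `kernelSum n N` as `N` tends to infinity, for `n ≥ 1`. -/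
noncomputable def kernelLimit (n : ℕ) : ℝ :=
  altHarmonic n 1 ^ 2 - Real.log 2 * altHarmonic n 1 - (Real.log 2 ^ 2 + zetaVal 2) / 2
    - harm n * altHarmonic n 1 + altHarmonicSum n + altHarmonic n 2
    - alt n * altHarmonic n 1 / (n : ℝ)

theorem tendsto_kernelSum {n : ℕ} (hn : 1 ≤ n) :
    Tendsto (kernelSum n) atTop (𝓝 (kernelLimit n)) := by
  have h := ((tendsto_altHarmonic.const_mul (altHarmonic n 1)).add
    (sumsTo_alt_mul_altHarmonic_add_div n)).const_sub
      (altHarmonic n 1 ^ 2 + altConv n - alt n * altHarmonic n 1 / (n : ℝ))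
  refine (tendsto_add_atTop_iff_nat n).1 ?_
  convert h using 2 with J
  · rw [add_comm, kernelSum_add hn]
  · rw [kernelLimit, harm_mul_altHarmonic, altConv_eq_sub]
    ring

theorem sum_one_div_mul_succ_le (J : ℕ) :
    ∑ j ∈ Icc 1 J, 1 / (j : ℝ) * (1 / ((j : ℝ) + 1)) ≤ 1 := by
  have : ∑ j ∈ Icc 1 J, 1 / (j : ℝ) * (1 / ((j : ℝ) + 1)) = 1 - 1 / ((J : ℝ) + 1) := by
    induction J with
    | zero => simp
    | succ J ih =>
      rw [sum_Icc_succ_top (by omega), ih]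
      push_cast
      field_simp
      ring
  rw [this]
  have : (0 : ℝ) ≤ 1 / ((J : ℝ) + 1) := by positivity
  linarith

/-- Uniformity in both `n` and `J` is what domination requires. Replacing `L_{n+j}` by `log 2` costs
at most `∑ 1 / (j (j + 1)) ≤ 1`, and the remainder `log 2 * L_J` is at most 2. -/
theorem abs_sum_alt_mul_altHarmonic_add_div_le (n J : ℕ) :
    |∑ j ∈ Icc 1 J, alt j * altHarmonic (n + j) 1 / (j : ℝ)| ≤ 3 := by
  have e : ∑ j ∈ Icc 1 J, alt j * altHarmonic (n + j) 1 / (j : ℝ) =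
      ∑ j ∈ Icc 1 J, alt j * (altHarmonic (n + j) 1 - Real.log 2) / (j : ℝ) +
        Real.log 2 * altHarmonic J 1 := by
    rw [altHarmonic_eq J, mul_sum, ← sum_add_distrib]
    refine sum_congr rfl fun j _ => ?_
    rw [pow_one]; ring
  have h1 : |∑ j ∈ Icc 1 J, alt j * (altHarmonic (n + j) 1 - Real.log 2) / (j : ℝ)| ≤ 1 := by
    refine (abs_sum_le_sum_abs _ _).trans
      ((sum_le_sum fun j _ => ?_).trans (sum_one_div_mul_succ_le J))
    rw [abs_div, abs_mul, abs_alt, one_mul, Nat.abs_cast, ← one_div_mul_eq_div]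
    gcongr
    refine (abs_altHarmonic_sub_log_two_le (n + j)).trans ?_
    push_cast
    have : (0 : ℝ) ≤ n := by positivity
    gcongr
    linarith
  have h2 : |Real.log 2 * altHarmonic J 1| ≤ 1 * 2 := by
    rw [abs_mul]
    have h3 := Real.log_two_lt_d9
    have h4 := Real.log_two_gt_d9
    gcongr
    · rw [abs_le]; constructor <;> linarith
    · exact abs_altHarmonic_le_two J
  rw [e]
  refine (abs_add_le _ _).trans ?_
  linarith

theorem abs_kernelSum_le {n N : ℕ} (hn : 1 ≤ n) (hN : n ≤ N) :
    |kernelSum n N| ≤ 17 * harm n ^ 2 := by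
  obtain ⟨J, rfl⟩ := Nat.exists_eq_add_of_le hN
  have hh := one_le_harm hn
  have hn1 : (1 : ℝ) ≤ n := by exact_mod_cast hn
  have hL := abs_altHarmonic_le_two n
  have hJ := abs_altHarmonic_le_two J
  have h1 : |altHarmonic n 1 ^ 2| ≤ 4 := by
    rw [abs_pow]; nlinarith [abs_nonneg (altHarmonic n 1)]
  have h2 : |altConv n| ≤ 2 * harm n + 2 := by
    have a1 := abs_altConv_sub_le n
    have a2 : 2 * harm n / ((n : ℝ) + 1) ≤ 2 * harm n := by
      apply div_le_self <;> linarith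
    have a3 : |altHarmonic n 1 * Real.log 2| ≤ 2 * 1 := by
      rw [abs_mul]
      have h3 := Real.log_two_lt_d9
      have h4 := Real.log_two_gt_d9
      gcongr
      rw [abs_le]; constructor <;> linarith
    rw [abs_le] at *
    constructor <;> linarith
  have h3 : |alt n * altHarmonic n 1 / (n : ℝ)| ≤ 2 := by
    rw [abs_div, abs_mul, abs_alt, one_mul, Nat.abs_cast]
    exact (div_le_self (abs_nonneg _) hn1).trans hL
  have h4 : |altHarmonic n 1 * altHarmonic J 1| ≤ 4 := by
    rw [abs_mul]; nlinarith [abs_nonneg (altHarmonic n 1), abs_nonneg (altHarmonic J 1)]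
  have h5 := abs_sum_alt_mul_altHarmonic_add_div_le n J
  have h6 : harm n ≤ harm n ^ 2 := by nlinarith
  -- The five bounds add up to `15 + 2 H_n`, which is at most `17 H_n²` because `H_n ≥ 1`.
  rw [kernelSum_add hn]
  rw [abs_le] at *
  constructor <;> linarith

theorem tendsto_sum_kernelSum {a : ℕ} (ha : 2 ≤ a) {X : ℝ}
    (hX : SumsTo (fun n => kernelLimit n / (n : ℝ) ^ a) X) :
    Tendsto (fun N => ∑ n ∈ Icc 1 N, kernelSum n N / (n : ℝ) ^ a) atTop (𝓝 X) := by
  have hb : Summable fun n : ℕ => 17 * harm n ^ 2 / (n : ℝ) ^ a :=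
    summable_div_pow_of_abs_le (C := 17) (fun n _ => by
      rw [abs_of_nonneg (by positivity)]) ha
  have hl : ∀ n, 1 ≤ n → |kernelLimit n| ≤ 17 * harm n ^ 2 := fun n hn =>
    le_of_tendsto (tendsto_kernelSum hn).abs
      ((eventually_ge_atTop n).mono fun N hN => abs_kernelSum_le hn hN)
  have h0 : kernelLimit 0 / ((0 : ℕ) : ℝ) ^ a = 0 := by simp; omega
  have hs := (hasSum_of_sumsTo (summable_div_pow_of_abs_le hl ha) h0 hX).tsum_eq
  -- The truncation at `N` affects both the range of `n` and the summand, so the finite sums are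
  -- extended by zero to a fixed index set.
  have key := tendsto_tsum_of_dominated_convergence (𝓕 := atTop) (β := ℕ)
    (f := fun N n => if n ∈ Icc 1 N then kernelSum n N / (n : ℝ) ^ a else 0)
    (g := fun n => kernelLimit n / (n : ℝ) ^ a) hb ?_ ?_
  · rw [hs] at key
    refine key.congr fun N => ?_
    rw [tsum_eq_sum (s := Icc 1 N) fun n hn => if_neg hn]
    exact sum_congr rfl fun n hn => if_pos hn
  · intro n
    rcases Nat.eq_zero_or_pos n with rfl | hn
    · simp only [h0]; simp
    · refine ((tendsto_kernelSum hn).div_const _).congr' ?_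
      filter_upwards [eventually_ge_atTop n] with N hN
      rw [if_pos (mem_Icc.2 ⟨hn, hN⟩)]
  · refine Eventually.of_forall fun N n => ?_
    split_ifs with h
    · rw [mem_Icc] at h
      rw [Real.norm_eq_abs, abs_div, abs_of_nonneg (show (0 : ℝ) ≤ (n : ℝ) ^ a by positivity)]
      gcongr
      exact abs_kernelSum_le h.1 h.2
    · rw [norm_zero]; positivity

/-! ### Harmonic-number series as double zeta-star values, and the limit of the product sum -/

theorem sumsTo_altHarmonic_div_pow {s : ℕ} (hs : 2 ≤ s) {t : ℕ} (ht : 1 ≤ t) :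
    SumsTo (fun n => altHarmonic n t / (n : ℝ) ^ s) (-zetaStar (.plain s) (.bar t)) := by
  refine (converges_zetaStarTerm (.plain s) (.bar t) hs ht).sumsTo.neg.congr fun n _ => ?_
  simp only [zetaStarTerm, Index.factor, altHarmonic_eq, neg_one_pow_eq, neg_div, sum_neg_distrib]
  ring

theorem sumsTo_alt_mul_altHarmonic_div_pow {s : ℕ} (hs : 1 ≤ s) {t : ℕ} (ht : 1 ≤ t) :
    SumsTo (fun n => alt n * altHarmonic n t / (n : ℝ) ^ s) (zetaStar (.bar s) (.bar t)) := by
  refine (converges_zetaStarTerm (.bar s) (.bar t) hs ht).sumsTo.congr fun n _ => ?_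
  simp only [zetaStarTerm, Index.factor, altHarmonic_eq, neg_one_pow_eq, neg_div, sum_neg_distrib]
  ring

theorem sumsTo_harm_div_pow {s : ℕ} (hs : 2 ≤ s) :
    SumsTo (fun n => harm n / (n : ℝ) ^ s) (zetaStar (.plain s) (.plain 1)) := by
  refine (converges_zetaStarTerm (.plain s) (.plain 1) hs le_rfl).sumsTo.congr fun n _ => ?_
  simp only [zetaStarTerm, Index.factor, harm_eq_sum, pow_one]
  ring

theorem sumsTo_alt_mul_harm_div_pow {s : ℕ} (hs : 1 ≤ s) :
    SumsTo (fun n => alt n * harm n / (n : ℝ) ^ s) (-zetaStar (.bar s) (.plain 1)) := by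
  refine (converges_zetaStarTerm (.bar s) (.plain 1) hs le_rfl).sumsTo.neg.congr fun n _ => ?_
  simp only [zetaStarTerm, Index.factor, harm_eq_sum, pow_one, neg_one_pow_eq]
  ring

theorem converges_altHarmonic_sq_div_pow {s : ℕ} (hs : 2 ≤ s) :
    Converges fun n => altHarmonic n 1 ^ 2 / (n : ℝ) ^ s :=
  converges_div_pow_of_abs_le (C := 1) (fun n _ => by
    rw [abs_pow, one_mul]
    gcongr
    exact abs_altHarmonic_le_harm n le_rfl) hs

theorem converges_harm_mul_altHarmonic_div_pow {s : ℕ} (hs : 2 ≤ s) :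
    Converges fun n => harm n * altHarmonic n 1 / (n : ℝ) ^ s :=
  converges_div_pow_of_abs_le (C := 1) (fun n _ => by
    rw [abs_mul, abs_of_nonneg (harm_nonneg n), one_mul, sq]
    have := harm_nonneg n
    gcongr
    exact abs_altHarmonic_le_harm n le_rfl) hs

theorem converges_altHarmonicSum_div_pow {s : ℕ} (hs : 2 ≤ s) :
    Converges fun n => altHarmonicSum n / (n : ℝ) ^ s :=
  converges_div_pow_of_abs_le (C := 2) (fun n hn => by
    have := abs_altHarmonicSum_le n
    have := one_le_harm hn
    nlinarith) hs

theorem sum_zetaStar_mul_altZeta {a : ℕ} (ha : 2 ≤ a) :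
    ∑ i ∈ Icc 1 a, zetaStar (.bar i) (.bar 1) * altZeta (a + 1 - i) =
      -a * zetaStar (.plain (a + 1)) (.bar 1)
      + series (fun n => altHarmonic n 1 ^ 2 / (n : ℝ) ^ a)
      + Real.log 2 * zetaStar (.plain a) (.bar 1)
      - (Real.log 2 ^ 2 + zetaVal 2) / 2 * zetaVal a
      - series (fun n => harm n * altHarmonic n 1 / (n : ℝ) ^ a)
      + series (fun n => altHarmonicSum n / (n : ℝ) ^ a)
      - zetaStar (.plain a) (.bar 2) - zetaStar (.bar (a + 1)) (.bar 1) := by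
  have h1 : Tendsto (fun N => ∑ i ∈ Icc 1 a,
      (∑ m ∈ Icc 1 N, alt m * altHarmonic m 1 / (m : ℝ) ^ i) *
        (∑ k ∈ Icc 1 N, alt k / (k : ℝ) ^ (a + 1 - i))) atTop
      (𝓝 (∑ i ∈ Icc 1 a, zetaStar (.bar i) (.bar 1) * altZeta (a + 1 - i))) := by
    refine tendsto_finsetSum _ fun i hi => ?_
    rw [mem_Icc] at hi
    exact Tendsto.mul (sumsTo_alt_mul_altHarmonic_div_pow hi.1 le_rfl)
      (sumsTo_alt_div_pow (by omega))
  simp only [sum_mul_eq_kernelSum] at h1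
  have hX := (((((((converges_altHarmonic_sq_div_pow ha).sumsTo.sub
    ((sumsTo_altHarmonic_div_pow ha le_rfl).const_mul (Real.log 2))).sub
    ((converges_zetaVal ha).sumsTo.const_mul ((Real.log 2 ^ 2 + zetaVal 2) / 2))).sub
    (converges_harm_mul_altHarmonic_div_pow ha).sumsTo).add
    (converges_altHarmonicSum_div_pow ha).sumsTo).add
    (sumsTo_altHarmonic_div_pow ha one_le_two)).sub
    (sumsTo_alt_mul_altHarmonic_div_pow (s := a + 1) (by omega) le_rfl)).congr
      (b := fun n => kernelLimit n / (n : ℝ) ^ a) fun n hn => by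
        have : (n : ℝ) ≠ 0 := by positivity
        rw [kernelLimit]
        field_simp
        ring
  have h2 := Tendsto.add (Tendsto.const_mul (a : ℝ)
    (sumsTo_altHarmonic_div_pow (s := a + 1) (by omega) le_rfl)) (tendsto_sum_kernelSum ha hX)
  rw [tendsto_nhds_unique h1 h2, ← zetaVal]
  ring

/-! ### The double sum `∑_{m, k} (-1)^(m+k) H_{m-1} / (m k^p (m + k))` -/

/-- The general term `(-1)^(m+k) H_{m-1} / (m k^p (m + k))`. -/
noncomputable def mixedTerm (p : ℕ) (q : ℕ × ℕ) : ℝ :=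
  alt q.1 * alt q.2 * harm (q.1 - 1) / ((q.1 : ℝ) * (q.2 : ℝ) ^ p * ((q.1 : ℝ) + q.2))

theorem summable_mixedTerm {p : ℕ} (hp : 1 ≤ p) : Summable (mixedTerm p) := by
  have h1 : Summable fun m : ℕ => 5 * (1 / (m : ℝ) ^ (5 / 4 : ℝ)) :=
    (Real.summable_one_div_nat_rpow.2 (by norm_num)).mul_left _
  have h2 : Summable fun k : ℕ => 1 / (k : ℝ) ^ (3 / 2 : ℝ) :=
    Real.summable_one_div_nat_rpow.2 (by norm_num)
  refine Summable.of_norm_bounded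
    (h1.mul_of_nonneg h2 (fun m => by positivity) (fun k => by positivity)) ?_
  rintro ⟨m, k⟩
  simp only [mixedTerm]
  rcases Nat.eq_zero_or_pos m with rfl | hm
  · simp
  rcases Nat.eq_zero_or_pos k with rfl | hk
  · simp [show p ≠ 0 by omega]
  have hm0 : (0 : ℝ) < m := by exact_mod_cast hm
  have hk0 : (0 : ℝ) < k := by exact_mod_cast hk
  have hk1 : (1 : ℝ) ≤ k := by exact_mod_cast hk
  have ha : harm (m - 1) ≤ 5 * (m : ℝ) ^ (1 / 4 : ℝ) :=
    (harm_mono (Nat.sub_le m 1)).trans (harm_le_rpow hm)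
  -- By AM-GM the factor `m + k` gives a half power to each variable, leaving `m^(-5/4)` and
  -- `k^(-3/2)`; this suffices already for `p = 1`.
  have hb : (m : ℝ) ^ (1 / 2 : ℝ) * (k : ℝ) ^ (1 / 2 : ℝ) ≤ (m : ℝ) + k := by
    rw [← Real.sqrt_eq_rpow, ← Real.sqrt_eq_rpow]
    nlinarith [sq_nonneg (√(m : ℝ) - √(k : ℝ)), Real.sq_sqrt hm0.le, Real.sq_sqrt hk0.le,
      Real.sqrt_nonneg (m : ℝ), Real.sqrt_nonneg (k : ℝ)]
  have hc : (k : ℝ) ≤ (k : ℝ) ^ p := le_self_pow₀ hk1 (by omega)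
  have e1 : (m : ℝ) ^ (1 / 4 : ℝ) * (m : ℝ) ^ (5 / 4 : ℝ) = m * (m : ℝ) ^ (1 / 2 : ℝ) := by
    nth_rw 3 [← Real.rpow_one (m : ℝ)]
    rw [← Real.rpow_add hm0, ← Real.rpow_add hm0]; norm_num
  have e2 : (k : ℝ) ^ (3 / 2 : ℝ) = k * (k : ℝ) ^ (1 / 2 : ℝ) := by
    nth_rw 2 [← Real.rpow_one (k : ℝ)]
    rw [← Real.rpow_add hk0]; norm_num
  rw [Real.norm_eq_abs, abs_div, abs_mul, abs_mul, abs_alt, abs_alt, one_mul, one_mul,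
    abs_of_nonneg (harm_nonneg _),
    abs_of_pos (show (0 : ℝ) < (m : ℝ) * (k : ℝ) ^ p * ((m : ℝ) + k) by positivity)]
  calc harm (m - 1) / ((m : ℝ) * (k : ℝ) ^ p * ((m : ℝ) + k))
      ≤ 5 * (m : ℝ) ^ (1 / 4 : ℝ) /
        ((m : ℝ) * k * ((m : ℝ) ^ (1 / 2 : ℝ) * (k : ℝ) ^ (1 / 2 : ℝ))) := by
        gcongr
    _ = 5 * (1 / (m : ℝ) ^ (5 / 4 : ℝ)) * (1 / (k : ℝ) ^ (3 / 2 : ℝ)) := by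
        rw [e2]
        have p1 : (m : ℝ) ^ (5 / 4 : ℝ) ≠ 0 := (Real.rpow_pos_of_pos hm0 _).ne'
        have p2 : (m : ℝ) ^ (1 / 2 : ℝ) ≠ 0 := (Real.rpow_pos_of_pos hm0 _).ne'
        have p3 : (k : ℝ) ^ (1 / 2 : ℝ) ≠ 0 := (Real.rpow_pos_of_pos hk0 _).ne'
        rw [mul_one_div, mul_one_div, div_div, div_eq_div_iff (by positivity) (by positivity)]
        linear_combination (5 * (k : ℝ) * (k : ℝ) ^ (1 / 2 : ℝ)) * e1

/-- The value of `∑_k (-1)^(k-1) / (k^p (k + m))`, from its partial fraction expansion. -/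
noncomputable def rowValue (p m : ℕ) : ℝ :=
  ∑ i ∈ Icc 1 p, (-1 : ℝ) ^ (i - 1) * altZeta (p + 1 - i) / (m : ℝ) ^ i +
    (-1 : ℝ) ^ p * (alt m * (altHarmonic m 1 - Real.log 2)) / (m : ℝ) ^ p

/-- This mirrors `1 / (k^(p+1) (k + m)) = (1 / m) (1 / k^(p+1) - 1 / (k^p (k + m)))`, on which the
induction for the row sums rests. -/
theorem rowValue_succ (p m : ℕ) :
    rowValue (p + 1) m = 1 / (m : ℝ) * (altZeta (p + 1) - rowValue p m) := by
  rw [rowValue, rowValue, add_comm p 1, sum_Icc_add]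
  have e : ∑ j ∈ Icc 1 p, (-1 : ℝ) ^ (1 + j - 1) * altZeta (1 + p + 1 - (1 + j)) / (m : ℝ) ^ (1 + j)
      = -(1 / (m : ℝ)) * ∑ i ∈ Icc 1 p, (-1 : ℝ) ^ (i - 1) * altZeta (p + 1 - i) / (m : ℝ) ^ i := by
    rw [mul_sum]
    refine sum_congr rfl fun j hj => ?_
    obtain ⟨i, rfl⟩ := Nat.exists_eq_add_of_le (mem_Icc.1 hj).1
    rw [show 1 + (1 + i) - 1 = i + 1 by omega, show 1 + i - 1 = i by omega,
      show 1 + p + 1 - (1 + (1 + i)) = p + 1 - (1 + i) by omega, pow_succ, pow_add _ 1 (1 + i)]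
    ring
  rw [e]
  simp only [Icc_self, sum_singleton, Nat.sub_self, pow_zero, one_mul, pow_one, pow_add,
    show 1 + p + 1 - 1 = 1 + p by omega]
  ring_nf

theorem sumsTo_rowValue (p : ℕ) {m : ℕ} (hm : 1 ≤ m) :
    SumsTo (fun k => alt k / ((k : ℝ) ^ p * ((k : ℝ) + m))) (rowValue p m) := by
  induction p with
  | zero => simpa [rowValue] using sumsTo_alt_div_add m
  | succ p ih =>
    rw [rowValue_succ]
    refine (((sumsTo_alt_div_pow (s := p + 1) (by omega)).sub ih).const_mul _).congr
      fun k hk => ?_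
    have h1 : (m : ℝ) ≠ 0 := by positivity
    have h2 : (k : ℝ) ≠ 0 := by positivity
    have h3 : (k : ℝ) + m ≠ 0 := by positivity
    field_simp
    ring

theorem sumsTo_alt_mul_harm_pred_div_pow {s : ℕ} (hs : 1 ≤ s) :
    SumsTo (fun m => alt m * harm (m - 1) / (m : ℝ) ^ s)
      (-zetaStar (.bar s) (.plain 1) - altZeta (s + 1)) := by
  refine ((sumsTo_alt_mul_harm_div_pow hs).sub
    (sumsTo_alt_div_pow (s := s + 1) (by omega))).congr fun m hm => ?_
  have : (m : ℝ) ≠ 0 := by positivity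
  rw [harm_pred]
  field_simp
  ring

/-- Evaluation of the double series by summing first over `k`. -/
theorem tsum_mixedTerm_eq_rows {p : ℕ} (hp : 1 ≤ p) :
    ∑' q, mixedTerm p q =
      ∑ i ∈ Icc 1 p, (-1 : ℝ) ^ (i - 1) * altZeta (p + 1 - i) *
        (-zetaStar (.bar (i + 1)) (.plain 1) - altZeta (i + 2))
      + (-1 : ℝ) ^ p * (series (fun n => harm n * altHarmonic n 1 / (n : ℝ) ^ (p + 1))
        + zetaStar (.plain (p + 2)) (.bar 1)
        - Real.log 2 * zetaStar (.plain (p + 1)) (.plain 1)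
        + Real.log 2 * zetaVal (p + 2)) := by
  have hs := summable_mixedTerm hp
  have hrow : ∀ m, HasSum (fun k => mixedTerm p (m, k))
      (alt m * harm (m - 1) / (m : ℝ) * rowValue p m) := by
    intro m
    rcases Nat.eq_zero_or_pos m with rfl | hm
    · simp [mixedTerm]
    refine hasSum_of_sumsTo (hs.prod_factor m) (by simp [mixedTerm, show p ≠ 0 by omega]) ?_
    refine ((sumsTo_rowValue p hm).const_mul _).congr fun k _ => ?_
    simp only [mixedTerm]
    rw [div_mul_div_comm, add_comm (k : ℝ)]
    ring
  have h1 : SumsTo (fun m => alt m * harm (m - 1) / (m : ℝ) * rowValue p m) _ :=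
    sumsTo_of_hasSum (hs.hasSum.prod_fiberwise hrow) (by simp)
  have h2 := (SumsTo.finset_sum (Icc 1 p) fun i hi =>
    (sumsTo_alt_mul_harm_pred_div_pow (s := i + 1) (by omega)).const_mul
      ((-1 : ℝ) ^ (i - 1) * altZeta (p + 1 - i))).add
    (((((converges_harm_mul_altHarmonic_div_pow (s := p + 1) (by omega)).sumsTo.sub
      (sumsTo_altHarmonic_div_pow (s := p + 2) (t := 1) (by omega) le_rfl)).sub
      ((sumsTo_harm_div_pow (s := p + 1) (by omega)).const_mul (Real.log 2))).add
      ((converges_zetaVal (s := p + 2) (by omega)).sumsTo.const_mul (Real.log 2))).const_mul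
        ((-1 : ℝ) ^ p))
  refine (h1.unique (h2.congr fun m hm => ?_)).trans ?_
  · have hm0 : (m : ℝ) ≠ 0 := by positivity
    rw [rowValue, mul_add (alt m * harm (m - 1) / (m : ℝ)), mul_sum]
    congr 1
    · refine sum_congr rfl fun i _ => ?_
      rw [pow_succ]
      field_simp
    · have := alt_mul_self m
      rw [harm_pred]
      trans (-1 : ℝ) ^ p * (alt m * alt m) * (harm m - 1 / (m : ℝ)) *
        (altHarmonic m 1 - Real.log 2) / (m : ℝ) ^ (p + 1)
      · rw [this]
        field_simp
        ring
      · ring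
  · rw [← zetaVal]; ring

/-- The closed form of `(-1)^k ∑_m (-1)^(m-1) H_{m-1} / (m + k)`. -/
noncomputable def colValue (k : ℕ) : ℝ :=
  -(Real.log 2 ^ 2) / 2 + Real.log 2 * altHarmonic k 1 + Real.log 2 * harm k - altHarmonicSum k

theorem sumsTo_alt_div_mul_add (k : ℕ) :
    SumsTo (fun m => alt m / ((m : ℝ) * ((m : ℝ) + k + 1)))
      (1 / ((k : ℝ) + 1) *
        (Real.log 2 - alt (k + 1) * (altHarmonic (k + 1) 1 - Real.log 2))) := by
  refine ((sumsTo_alt_div.sub (sumsTo_alt_div_add (k + 1))).const_mul _).congr fun m hm => ?_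
  have h1 : (m : ℝ) ≠ 0 := by positivity
  have h2 : (m : ℝ) + k + 1 ≠ 0 := by positivity
  push_cast
  rw [← add_assoc]
  field_simp
  ring

theorem sumsTo_alt_mul_harm_pred_div_add (k : ℕ) :
    SumsTo (fun m => alt m * harm (m - 1) / ((m : ℝ) + k)) (-alt k * colValue k) := by
  induction k with
  | zero =>
    simpa [colValue, alt, altHarmonic, harm, altHarmonicSum] using sumsTo_alt_mul_harm_pred_div
  | succ k ih =>
    -- Shifting `m` by one reverses the sign and turns `m + k + 1` into `m + k`, while `H_m -
    -- H_{m-1} = 1 / m` yields the last sum. The extra initial term vanishes since `H_0 = 0`.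
    have key : ∀ N : ℕ, ∑ m ∈ Icc 1 N, alt m * harm (m - 1) / ((m : ℝ) + (k + 1 : ℕ)) =
        -(∑ m ∈ Icc 1 (N + 1), alt m * harm (m - 1) / ((m : ℝ) + k)) -
          ∑ m ∈ Icc 1 N, alt m / ((m : ℝ) * ((m : ℝ) + k + 1)) := by
      intro N
      induction N with
      | zero => simp [harm]
      | succ N ih =>
        rw [sum_Icc_succ_top (by omega), ih, sum_Icc_succ_top (b := N + 1) (by omega),
          sum_Icc_succ_top (b := N) (f := fun m : ℕ => alt m / ((m : ℝ) * ((m : ℝ) + k + 1)))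
            (by omega), alt_succ (N + 1), Nat.add_sub_cancel, Nat.add_sub_cancel, harm_succ]
        push_cast
        have h1 : (N : ℝ) + 1 ≠ 0 := by positivity
        have h2 : (N : ℝ) + 1 + k + 1 ≠ 0 := by positivity
        rw [show (N : ℝ) + 1 + 1 + k = N + 1 + k + 1 by ring,
          show (N : ℝ) + 1 + (k + 1) = N + 1 + k + 1 by ring]
        field_simp
        ring
    have h : SumsTo _ _ :=
      (((tendsto_add_atTop_iff_nat 1).2 ih).neg.sub (sumsTo_alt_div_mul_add k)).congr
        fun N => (key N).symm
    convert h using 1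
    have := alt_mul_self k
    rw [colValue, colValue, altHarmonicSum_succ, harm_succ, altHarmonic_one_succ, alt_succ]
    field_simp
    linear_combination (-2 * Real.log 2 * ((k : ℝ) + 1)) * this

/-- Evaluation of the double series by summing first over `m`. -/
theorem tsum_mixedTerm_eq_cols {p : ℕ} (hp : 1 ≤ p) :
    ∑' q, mixedTerm p q =
      -(Real.log 2 ^ 2) / 2 * (zetaVal (p + 1) + altZeta (p + 1))
      - Real.log 2 * zetaStar (.plain (p + 1)) (.bar 1)
      + Real.log 2 * zetaStar (.plain (p + 1)) (.plain 1)
      - series (fun n => altHarmonicSum n / (n : ℝ) ^ (p + 1)) := by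
  have hs := (Equiv.prodComm ℕ ℕ).summable_iff.2 (summable_mixedTerm hp)
  have hcol : ∀ k, HasSum (fun m => mixedTerm p (m, k))
      (alt k / (k : ℝ) ^ (p + 1) * (-(Real.log 2 ^ 2) / 2 + alt k * colValue k)) := by
    intro k
    rcases Nat.eq_zero_or_pos k with rfl | hk
    · simp [mixedTerm, show p ≠ 0 by omega]
    refine hasSum_of_sumsTo (hs.prod_factor k) (by simp [mixedTerm]) ?_
    -- Partial fractions `1 / (m (m + k)) = (1 / k) (1 / m - 1 / (m + k))` reduce the column to two
    -- known sums.
    have h := (sumsTo_alt_mul_harm_pred_div.sub (sumsTo_alt_mul_harm_pred_div_add k)).const_mul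
      (alt k / (k : ℝ) ^ (p + 1))
    rw [neg_mul, sub_neg_eq_add] at h
    refine h.congr fun m hm => ?_
    have h1 : (m : ℝ) ≠ 0 := by positivity
    have h2 : (k : ℝ) ≠ 0 := by positivity
    have h3 : (m : ℝ) + k ≠ 0 := by positivity
    simp only [mixedTerm]
    field_simp
    ring
  have h1 : SumsTo _ _ := sumsTo_of_hasSum (hs.hasSum.prod_fiberwise hcol) (by simp)
  have h2 := (((((converges_zetaVal (s := p + 1) (by omega)).sumsTo.add
    (sumsTo_alt_div_pow (s := p + 1) (by omega))).const_mul (-(Real.log 2 ^ 2) / 2)).add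
    ((sumsTo_altHarmonic_div_pow (s := p + 1) (t := 1) (by omega) le_rfl).const_mul
      (Real.log 2))).add
    ((sumsTo_harm_div_pow (s := p + 1) (by omega)).const_mul (Real.log 2))).sub
    (converges_altHarmonicSum_div_pow (s := p + 1) (by omega)).sumsTo
  rw [← (Equiv.prodComm ℕ ℕ).tsum_eq]
  refine (h1.unique (h2.congr fun k hk => ?_)).trans ?_
  · have hk0 : (k : ℝ) ≠ 0 := by positivity
    have := alt_mul_self k
    rw [colValue]
    field_simp
    linear_combination (-(-(Real.log 2 ^ 2) + 2 * Real.log 2 * altHarmonic k 1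
      + 2 * Real.log 2 * harm k - 2 * altHarmonicSum k)) * this
  · rw [← zetaVal]; ring

end EulerSum

/-! ### Assembly of the identity -/

theorem theorem3p3 (p : ℕ) (hp : 1 ≤ p) :
    -- every series that occurs in the identity converges
    EulerSum.Converges (fun n => EulerSum.altHarmonic n 1 ^ 2 / (n : ℝ) ^ (p + 1)) ∧
    EulerSum.Converges
      (fun n => (harmonic n : ℝ) * EulerSum.altHarmonic n 1 / (n : ℝ) ^ (p + 1)) ∧
    (∀ s : ℕ, 2 ≤ s → EulerSum.Converges (fun n => 1 / (n : ℝ) ^ s)) ∧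
    (∀ s : ℕ, 1 ≤ s → EulerSum.Converges (fun n => (-1 : ℝ) ^ (n - 1) / (n : ℝ) ^ s)) ∧
    (∀ i j : EulerSum.Index, i.Leading → 1 ≤ j.weight →
      EulerSum.Converges (EulerSum.zetaStarTerm i j)) ∧
    -- the identity
    EulerSum.series (fun n => EulerSum.altHarmonic n 1 ^ 2 / (n : ℝ) ^ (p + 1)) +
        ((-1 : ℝ) ^ (p - 1) - 1) * EulerSum.series
          (fun n => (harmonic n : ℝ) * EulerSum.altHarmonic n 1 / (n : ℝ) ^ (p + 1)) =
      EulerSum.zetaStar (.plain (p + 1)) (.bar 2)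
      - Real.log 2 * EulerSum.zetaStar (.plain (p + 1)) (.bar 1)
      + EulerSum.zetaStar (.bar (p + 2)) (.bar 1)
      + 1 / 2 * EulerSum.zetaVal 2 * EulerSum.zetaVal (p + 1)
      + ∑ i ∈ Finset.Icc 1 (p + 1),
          EulerSum.zetaStar (.bar i) (.bar 1) * EulerSum.altZeta (p + 2 - i)
      + ((p : ℝ) + 1 + (-1 : ℝ) ^ p) * EulerSum.zetaStar (.plain (p + 2)) (.bar 1)
      + 1 / 2 * Real.log 2 ^ 2 * (2 * EulerSum.zetaVal (p + 1) + EulerSum.altZeta (p + 1))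
      + Real.log 2 * (-1 : ℝ) ^ (p - 1) *
          (EulerSum.zetaStar (.plain (p + 1)) (.plain 1)
            - EulerSum.zetaStar (.bar (p + 1)) (.plain 1))
      - ∑ i ∈ Finset.Icc 1 (p - 1),
          (-1 : ℝ) ^ (i - 1) * EulerSum.altZeta (p + 1 - i) *
            EulerSum.zetaStar (.bar (i + 1)) (.plain 1)
      - Real.log 2 *
          (EulerSum.zetaStar (.plain (p + 1)) (.plain 1)
            - EulerSum.zetaStar (.plain (p + 1)) (.bar 1))
      - ∑ i ∈ Finset.Icc 1 (p - 1),
          (-1 : ℝ) ^ (i - 1) * EulerSum.altZeta (p + 1 - i) * EulerSum.altZeta (i + 2)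
      - Real.log 2 * (-1 : ℝ) ^ (p - 1) *
          (EulerSum.zetaVal (p + 2) + EulerSum.altZeta (p + 2)) := by
  open EulerSum in
  have hp1 : 2 ≤ p + 1 := by omega
  refine ⟨converges_altHarmonic_sq_div_pow hp1, converges_harm_mul_altHarmonic_div_pow hp1,
    fun s hs => converges_zetaVal hs, fun s hs => converges_altZeta hs,
    converges_zetaStarTerm, ?_⟩
  have hP := sum_zetaStar_mul_altZeta hp1
  have hT := (tsum_mixedTerm_eq_rows hp).symm.trans (tsum_mixedTerm_eq_cols hp)
  obtain ⟨r, rfl⟩ := Nat.exists_eq_add_of_le' hp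
  -- The term `i = p` of the row sum carries `altZeta 1 = log 2`; it supplies the separate `log 2`
  -- terms with `ζ⋆` of `p + 1` barred and 1, and with `altZeta (p + 2)`.
  rw [Finset.sum_Icc_succ_top (by omega), show r + 1 + 1 - (r + 1) = 1 by omega, altZeta_one] at hT
  have hsum : ∑ i ∈ Finset.Icc 1 r, (-1 : ℝ) ^ (i - 1) * altZeta (r + 1 + 1 - i) *
        (-zetaStar (.bar (i + 1)) (.plain 1) - altZeta (i + 2)) =
      -∑ i ∈ Finset.Icc 1 r, (-1 : ℝ) ^ (i - 1) * altZeta (r + 1 + 1 - i) *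
        zetaStar (.bar (i + 1)) (.plain 1) -
      ∑ i ∈ Finset.Icc 1 r, (-1 : ℝ) ^ (i - 1) * altZeta (r + 1 + 1 - i) * altZeta (i + 2) := by
    rw [← Finset.sum_neg_distrib, ← Finset.sum_sub_distrib]
    exact Finset.sum_congr rfl fun i _ => by ring
  rw [hsum] at hT
  simp only [harm] at hT hP
  simp only [Nat.add_sub_cancel, show r + 1 + 2 = r + 1 + 1 + 1 from rfl,
    pow_succ (-1 : ℝ) r] at *
  rw [hP]
  push_cast
  linear_combination -hT
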